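/- Let $\Bbbk$ be an algebraically closed field of characteristic zero, let $N\ge 0$ and $s\ge 1$ be integers, and let $X\subset\mathbb{P}^N=\mathbb{P}^N_{\Bbbk}$ be an irreducible (Zariski closed) projective variety that is non-degenerate, i.e. not contained in a proper linear subspace of $\mathbb{P}^N$. Write $\langle\,\cdot\,\rangle$ for the linear span in $\mathbb{P}^N$, and let $$\sigma_s(X)=\overline{\bigcup_{P_1,\ldots,P_s\in X}\langle P_1,\ldots,P_s\rangle}\subset\mathbb{P}^N$$ (Zariski closure) be the $s$-th secant variety of $X$. For a Zariski closed set $Y\subset\mathbb{P}^N$ and $P\in Y$, let $T_P(Y)\subset\mathbb{P}^N$ be the embedded projective tangent space, i.e. the linear subspace of all $[v_0:\cdots:v_N]$ with $\sum_j \frac{\partial F}{\partial x_j}(P)\,v_j=0$ for every homogeneous polynomial $F$ vanishing on $Y$. Then, for generic $P_1,\ldots,P_s\in X$ and a generic point $Q\in\langle P_1,\ldots,P_s\rangle$, $$T_Q(\sigma_s(X))=\langle T_{P_1}(X),\ldots,T_{P_s}(X)\rangle .$$ Here "generic" means: there is a Zariski open dense subset $U$ of the product variety $X^s=X\times\cdots\times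 X$ such that for every $(P_1,\ldots,P_s)\in U$ there is a Zariski open dense subset $V$ of the linear space $\langle P_1,\ldots,P_s\rangle$ such that the equality holds for all $Q\in V$. -/

import Mathlib

open scoped LinearAlgebra.Projectivization Topology

noncomputable section

namespace Terracini

/-- The projective space `ℙ^N` over `k`, as the set of lines in `k^(N+1)`. -/
abbrev PP (k : Type*) [Field k] (N : ℕ) : Type _ := ℙ k (Fin (N + 1) → k)

/-- A form vanishes at a point of `ℙ^N`. Only used for homogeneous `F`, for which this does not
depend on the chosen representative of the point (see `vanishesAt_mk_iff`). -/
def VanishesAt {k : Type*} [Field k] {N : ℕ} (F : MvPolynomial (Fin (N + 1)) k) (P : PP k N) :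
    Prop :=
  MvPolynomial.eval P.rep F = 0

theorem vanishesAt_mk_iff {k : Type*} [Field k] {N : ℕ} {F : MvPolynomial (Fin (N + 1)) k} {d : ℕ}
    (hF : F.IsHomogeneous d) (v : Fin (N + 1) → k) (hv : v ≠ 0) :
    VanishesAt F (Projectivization.mk k v hv) ↔ MvPolynomial.eval v F = 0 := by
  obtain ⟨a, ha⟩ := Projectivization.exists_smul_eq_mk_rep k v hv
  unfold VanishesAt
  rw [← ha]
  have h : MvPolynomial.eval (a • v) F = (a : k) ^ d * MvPolynomial.eval v F := by
    rw [MvPolynomial.eval_eq, MvPolynomial.eval_eq, Finset.mul_sum]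
    refine Finset.sum_congr rfl fun m hm => ?_
    have hd : m.degree = d := by
      rw [Finsupp.degree_eq_weight_one (R := ℕ)]
      exact hF (MvPolynomial.mem_support_iff.1 hm)
    have : ∏ i ∈ m.support, (a • v) i ^ m i = (a : k) ^ d * ∏ i ∈ m.support, v i ^ m i := by
      simp only [Pi.smul_apply, Units.smul_def, smul_eq_mul, mul_pow, Finset.prod_mul_distrib,
        Finset.prod_pow_eq_pow_sum]
      rw [← hd, Finsupp.degree_apply]
    rw [this]; ring
  rw [h]
  simp

/-- The Zariski topology on `ℙ^N`: the complements of hypersurfaces form a basis. -/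
abbrev zariski (k : Type*) [Field k] (N : ℕ) : TopologicalSpace (PP k N) :=
  TopologicalSpace.generateFrom
    {U | ∃ (F : MvPolynomial (Fin (N + 1)) k) (d : ℕ),
      F.IsHomogeneous d ∧ U = {P | ¬ VanishesAt F P}}

/-- A polynomial in `s` groups of `N + 1` variables that is homogeneous of degree `d i` in the
`i`-th group of variables, for every `i`. -/
def IsMultihomogeneous {k : Type*} [Field k] {N s : ℕ}
    (F : MvPolynomial (Fin s × Fin (N + 1)) k) (d : Fin s → ℕ) : Prop :=
  ∀ m ∈ F.support, ∀ i, ∑ j, m (i, j) = d i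

/-- The Zariski topology on the `s`-fold product variety `ℙ^N × ⋯ × ℙ^N` (finer than the product
of the Zariski topologies): the complements of the zero loci of multihomogeneous polynomials form a
basis. -/
abbrev zariskiPower (k : Type*) [Field k] (N s : ℕ) : TopologicalSpace (Fin s → PP k N) :=
  TopologicalSpace.generateFrom
    {U | ∃ (F : MvPolynomial (Fin s × Fin (N + 1)) k) (d : Fin s → ℕ),
      IsMultihomogeneous F d ∧
        U = {P | MvPolynomial.eval (fun ij => (P ij.1).rep ij.2) F ≠ 0}}

/-- Zariski closed irreducible (in particular non-empty) subsets of `ℙ^N`. -/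
structure IsIrreducibleVariety {k : Type*} [Field k] {N : ℕ} (X : Set (PP k N)) : Prop where
  isClosed : IsClosed[zariski k N] X
  isIrreducible : @IsIrreducible _ (zariski k N) X

/-- `X` is not contained in a proper linear subspace of `ℙ^N`. -/
def IsNondegenerate {k : Type*} [Field k] {N : ℕ} (X : Set (PP k N)) : Prop :=
  ∀ L : Projectivization.Subspace k (Fin (N + 1) → k), X ⊆ L → L = ⊤

/-- The property `p` holds at a generic point of `Z`: it holds at all points of a (relatively) open
and dense subset `Z ∩ U` of `Z`. -/
def HoldsGenerically {α : Type*} (t : TopologicalSpace α) (Z : Set α) (p : α → Prop) : Prop :=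
  ∃ U : Set α, IsOpen[t] U ∧ Z ⊆ closure[t] (Z ∩ U) ∧ ∀ x ∈ Z ∩ U, p x

/-- The `s`-th secant variety: the Zariski closure of the union of the linear spans of all
`s`-tuples of points of `X`. -/
def secantVariety {k : Type*} [Field k] {N : ℕ} (s : ℕ) (X : Set (PP k N)) : Set (PP k N) :=
  closure[zariski k N]
    {Q | ∃ P : Fin s → PP k N, (∀ i, P i ∈ X) ∧ Q ∈ Projectivization.Subspace.span (Set.range P)}

/-- The affine cone over the embedded tangent space of `X` at `P`: the common kernel of the
differentials at `P` of all forms that vanish on `X`. -/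
def affineTangentSpace {k : Type*} [Field k] {N : ℕ} (X : Set (PP k N)) (P : PP k N) :
    Submodule k (Fin (N + 1) → k) where
  carrier := {v | ∀ (F : MvPolynomial (Fin (N + 1)) k) (d : ℕ), F.IsHomogeneous d →
    (∀ R ∈ X, VanishesAt F R) →
      ∑ j, MvPolynomial.eval P.rep (MvPolynomial.pderiv j F) * v j = 0}
  zero_mem' := by
    intro F d _ _
    simp
  add_mem' := by
    intro v w hv hw F d hF hX
    simp only [Pi.add_apply, mul_add, Finset.sum_add_distrib]
    rw [hv F d hF hX, hw F d hF hX, add_zero]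
  smul_mem' := by
    intro c v hv F d hF hX
    simp only [Pi.smul_apply, smul_eq_mul, mul_left_comm _ c, ← Finset.mul_sum]
    rw [hv F d hF hX, mul_zero]

/-- The (embedded, projective) Zariski tangent space `T_P(X) ⊆ ℙ^N` of `X` at `P`. -/
def tangentSpace {k : Type*} [Field k] {N : ℕ} (X : Set (PP k N)) (P : PP k N) :
    Projectivization.Subspace k (Fin (N + 1) → k) :=
  (affineTangentSpace X P).projectivization

end Terracini

end

/-!
Write `C ⊆ k ^ (N + 1)` for the affine cone over `X`. A form vanishes on `σ_s(X)` exactly when it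
vanishes on the set `S` of sums `p₁ + ⋯ + p_s` of elements of `C`
(`vanishes_on_cone_secantVariety_iff`), so that Terracini's lemma compares the tangent space of `S`
at `p₁ + ⋯ + p_s` with the sum of the tangent spaces of `C` at the `p_i`.

One inclusion holds at every point of `C ^ s`: if `F` vanishes on `S`, then its translate by the sum
of the `p_l` with `l ≠ i` vanishes on `C` (`coneTangent_le_coneTangent_sums`).

The other inclusion is generic smoothness of the addition map `C ^ s → S`, obtained from the generic
point (`exists_coneTangent_sums_le`). The vanishing ideal of `C ^ s` is prime, as `C` is irreducible
(`isPrime_vanishingIdeal_power`); let `A` be the coordinate ring, `L` its fraction field,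
`ξ_i ∈ L ^ (N + 1)` the generic points of the factors and `η` their sum. A vector `u` over `L` that
is tangent to `S` at `η` is a derivation into `L` of the subalgebra generated by the coordinates of
`η`. In characteristic zero `L` is formally smooth over that subalgebra, so the derivation extends to
a derivation `D` of `L` (`exists_derivation_of_forall_relation`). Then `u = D η` is the sum of the
vectors `D ξ_i`, which are tangent to `C` at `ξ_i`. To specialize this to closed points, a projection
`π` onto the tangent space at `η` is chosen: its columns are sums of tangent vectors at the `ξ_i`,
and the rows of `1 - π` are combinations of differentials of polynomials that vanish on `S`.
After clearing denominators this is an identity over `A` that can be evaluated at points of `C ^ s`.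
Where the common denominator `f` does not vanish, it gives the inclusion.

It remains to turn the condition `f ≠ 0` on `C ^ s` into Zariski open conditions on tuples of points
of `X` and on points of their span. For this, `f` is replaced by its homogeneous components: some
component is non-zero at `x` if and only if `f` is non-zero at some scaling of `x` (`scalePoly`). As
the points of a tuple may be dependent, a point of the span does not determine its coefficients; the
open subset of the span is defined by a linear choice of them, shifted by a suitable relation
(`holdsGenerically_span_of_scalePoly_ne_zero`).
-/

noncomputable section

namespace Terracini

open MvPolynomial

/-! ### Scaling groups of variables and homogeneous components -/

section Scaling

variable {k σ ι : Type*} [Field k]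

/-- The polynomial `f (t (g j) * x j)` in the variables `t`: its value at `t` is the value of `f` at
the point obtained from `x` by scaling each group of coordinates `g ⁻¹' {i}` by `t i`. -/
def scalePoly (g : σ → ι) (x : σ → k) : MvPolynomial σ k →ₐ[k] MvPolynomial ι k :=
  aeval fun j => C (x j) * X (g j)

/-- The component of `f` that is homogeneous of degree `e i` in each group of variables
`g ⁻¹' {i}`. -/
abbrev groupComponent (g : σ → ι) (e : ι →₀ ℕ) (f : MvPolynomial σ k) : MvPolynomial σ k :=
  weightedHomogeneousComponent (fun j => Finsupp.single (g j) 1) e f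

theorem eval_scalePoly (g : σ → ι) (x : σ → k) (f : MvPolynomial σ k) (t : ι → k) :
    eval t (scalePoly g x f) = eval (fun j => t (g j) * x j) f := by
  induction f using MvPolynomial.induction_on with
  | C a => simp [scalePoly]
  | add p q hp hq => rw [map_add, map_add, map_add, hp, hq]
  | mul_X p n hp =>
    rw [map_mul, map_mul, map_mul, hp]
    simp [scalePoly, mul_comm]

theorem scalePoly_monomial (g : σ → ι) (x : σ → k) (m : σ →₀ ℕ) (a : k) :
    scalePoly g x (monomial m a) =
      monomial (Finsupp.weight (fun j => Finsupp.single (g j) 1) m) (eval x (monomial m a)) := by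
  rw [scalePoly, aeval_monomial, eval_monomial, Finsupp.weight_apply, Finsupp.sum,
    monomial_sum_index, C_mul, algebraMap_eq, mul_assoc]
  congr 1
  simp only [Finsupp.prod, mul_pow, Finset.prod_mul_distrib, map_prod, map_pow,
    Finsupp.smul_single, smul_eq_mul, mul_one, X_pow_eq_monomial]

theorem coeff_scalePoly (g : σ → ι) (x : σ → k) (f : MvPolynomial σ k) (e : ι →₀ ℕ) :
    coeff e (scalePoly g x f) = eval x (groupComponent g e f) := by
  classical
  induction f using MvPolynomial.induction_on' with
  | monomial m a =>
    rw [scalePoly_monomial, coeff_monomial, groupComponent]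
    split_ifs with h
    · subst h
      rw [IsWeightedHomogeneous.weightedHomogeneousComponent_same
        (isWeightedHomogeneous_monomial _ _ _ rfl)]
    · rw [IsWeightedHomogeneous.weightedHomogeneousComponent_ne _
        (isWeightedHomogeneous_monomial _ m a rfl) (Ne.symm h), map_zero]
  | add p q hp hq =>
    rw [map_add, coeff_add, hp, hq]
    simp only [groupComponent, map_add]

/-- Together with `scalePoly_ne_zero_iff_exists_eval`: the components of `f` detect whether `f`
vanishes at all scalings of `x`. -/
theorem scalePoly_ne_zero_iff_exists_component {g : σ → ι} {x : σ → k} {f : MvPolynomial σ k} :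
    scalePoly g x f ≠ 0 ↔ ∃ e, eval x (groupComponent g e f) ≠ 0 := by
  simp only [MvPolynomial.ne_zero_iff, coeff_scalePoly]

theorem scalePoly_ne_zero_iff_exists_eval [Infinite k] {g : σ → ι} {x : σ → k}
    {f : MvPolynomial σ k} :
    scalePoly g x f ≠ 0 ↔ ∃ t : ι → k, eval (fun j => t (g j) * x j) f ≠ 0 := by
  simp only [← eval_scalePoly]
  refine ⟨fun h => ?_, fun ⟨t, ht⟩ h => ht (by rw [h, map_zero])⟩
  contrapose! h
  exact MvPolynomial.funext fun t => by rw [h t, map_zero]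

/-- If `f` vanishes on a set that is stable under scaling of the groups of coordinates, then so do
the components of `f`. -/
theorem eval_groupComponent_eq_zero [Infinite k] {g : σ → ι} {Z : Set (σ → k)}
    (hZ : ∀ x ∈ Z, ∀ t : ι → k, (fun j => t (g j) * x j) ∈ Z) {f : MvPolynomial σ k}
    (hf : ∀ x ∈ Z, eval x f = 0) (e : ι →₀ ℕ) {x : σ → k} (hx : x ∈ Z) :
    eval x (groupComponent g e f) = 0 := by
  by_contra h
  obtain ⟨t, ht⟩ := scalePoly_ne_zero_iff_exists_eval.1
    (scalePoly_ne_zero_iff_exists_component.2 ⟨e, h⟩)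
  exact ht (hf _ (hZ x hx t))

theorem mem_of_forall_groupComponent_mem {g : σ → ι} {f : MvPolynomial σ k}
    (S : Submodule k (MvPolynomial σ k)) (h : ∀ e, groupComponent g e f ∈ S) : f ∈ S := by
  rw [← sum_weightedHomogeneousComponent (fun j => Finsupp.single (g j) 1) f]
  exact finsum_induction (· ∈ S) S.zero_mem (fun _ _ => S.add_mem) h

theorem groupComponent_degree (g : σ → ι) (e : ι →₀ ℕ) (f : MvPolynomial σ k) {m : σ →₀ ℕ}
    (hm : m ∈ (groupComponent g e f).support) :
    Finsupp.weight (fun j => Finsupp.single (g j) 1) m = e :=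
  weightedHomogeneousComponent_isWeightedHomogeneous _ _ (mem_support_iff.1 hm)

/-- With a single group of variables, the components are forms. -/
theorem isHomogeneous_groupComponent (e : Unit →₀ ℕ) (f : MvPolynomial σ k) :
    (groupComponent (fun _ => ()) e f).IsHomogeneous (e ()) := by
  intro m hm
  rw [← groupComponent_degree _ e f (mem_support_iff.2 hm)]
  simp [Finsupp.weight_apply, Finsupp.sum, Finsupp.finsetSum_apply]

theorem isMultihomogeneous_groupComponent {N s : ℕ} (e : Fin s →₀ ℕ)
    (f : MvPolynomial (Fin s × Fin (N + 1)) k) :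
    IsMultihomogeneous (groupComponent Prod.fst e f) e := by
  classical
  intro m hm i
  rw [← groupComponent_degree _ e f hm, Finsupp.weight_apply, Finsupp.sum_fintype _ _ (by simp),
    Finsupp.finsetSum_apply, Fintype.sum_prod_type, Finset.sum_eq_single i]
  · simp
  · intro b _ hb
    simp [hb]
  · simp

theorem eval_smul_of_isHomogeneous {F : MvPolynomial σ k} {d : ℕ} (hF : F.IsHomogeneous d) (c : k)
    (x : σ → k) : eval (c • x) F = c ^ d * eval x F := by
  rw [eval_eq, eval_eq, Finset.mul_sum]
  refine Finset.sum_congr rfl fun m hm => ?_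
  rw [mul_left_comm, hF.degree_eq_sum_deg_support hm]
  simp only [Pi.smul_apply, smul_eq_mul, mul_pow, Finset.prod_mul_distrib,
    Finset.prod_pow_eq_pow_sum]

theorem eval_scale_of_isMultihomogeneous {N s : ℕ} {F : MvPolynomial (Fin s × Fin (N + 1)) k}
    {d : Fin s → ℕ} (hF : IsMultihomogeneous F d) (t : Fin s → k)
    (x : Fin s × Fin (N + 1) → k) :
    eval (fun ij => t ij.1 * x ij) F = (∏ i, t i ^ d i) * eval x F := by
  rw [eval_eq', eval_eq', Finset.mul_sum]
  refine Finset.sum_congr rfl fun m hm => ?_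
  rw [mul_left_comm]
  congr 1
  simp only [mul_pow, Finset.prod_mul_distrib]
  congr 1
  rw [Fintype.prod_prod_type]
  refine Finset.prod_congr rfl fun i _ => ?_
  rw [← hF m hm i, ← Finset.prod_pow_eq_pow_sum]

end Scaling

/-! ### Extension of derivations in characteristic zero -/

section Derivations

/-- The chain rule for polynomials in several variables. -/
theorem derivation_aeval {k A M n : Type*} [CommRing k] [CommRing A] [Algebra k A]
    [AddCommGroup M] [Module A M] [Module k M] [Fintype n]
    (D : Derivation k A M) (x : n → A) (F : MvPolynomial n k) :
    D (aeval x F) = ∑ j, aeval x (pderiv j F) • D (x j) := by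
  classical
  induction F using MvPolynomial.induction_on with
  | C a => simp
  | add p q hp hq => simp [hp, hq, add_smul, Finset.sum_add_distrib]
  | mul_X p i hp =>
    simp only [map_mul, aeval_X, Derivation.leibniz, hp, pderiv_X, map_add, smul_eq_mul, add_smul,
      Finset.sum_add_distrib, Finset.smul_sum, mul_smul]
    congr 1
    rw [Finset.sum_eq_single i]
    · simp
    · intro b _ hb; simp [hb.symm]
    · simp

/-- A derivation with values in a field extends along formally smooth maps into that field. -/
theorem exists_derivation_extension {k B L : Type*} [CommRing k] [CommRing B] [Field L]
    [Algebra k B] [Algebra k L] [Algebra B L] [IsScalarTower k B L] [Algebra.FormallySmooth B L]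
    (d : Derivation k B L) : ∃ D : Derivation k L L, ∀ b, D (algebraMap B L b) = d b := by
  have hinj : Function.Injective (KaehlerDifferential.mapBaseChange k B L) := by
    rw [injective_iff_map_eq_zero]
    intro x hx
    obtain ⟨y, rfl⟩ := (Algebra.H1Cotangent.exact_δ_mapBaseChange k B L x).mp hx
    rw [Subsingleton.elim y 0, map_zero]
  obtain ⟨r, hr⟩ := LinearMap.exists_leftInverse_of_injective
    (KaehlerDifferential.mapBaseChange k B L) (LinearMap.ker_eq_bot.2 hinj)
  let φ : TensorProduct B L (Ω[B⁄k]) →ₗ[L] L :=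
    LinearMap.liftBaseChange L d.liftKaehlerDifferential
  refine ⟨(φ ∘ₗ r).compDer (KaehlerDifferential.D k L), fun b => ?_⟩
  have h := LinearMap.congr_fun hr (1 ⊗ₜ[B] KaehlerDifferential.D k B b)
  simp at h
  simp [h, φ]

/-- In characteristic zero a finitely generated extension of the fraction field of `B` is separably
generated, hence formally smooth over `B`. -/
theorem formallySmooth_of_charZero {k B L : Type*} [Field k] [CharZero k] [CommRing B] [IsDomain B]
    [Field L] [Algebra k B] [Algebra k L] [Algebra B L] [IsScalarTower k B L]
    [FaithfulSMul B L] [Algebra.EssFiniteType k L] : Algebra.FormallySmooth B L := by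
  let K := FractionRing B
  let : Algebra K L := FractionRing.liftAlgebra B L
  have : IsScalarTower B K L := FractionRing.isScalarTower_liftAlgebra B L
  have : IsScalarTower k K L := .to₁₃₄ k B K L
  have : CharZero K := charZero_of_injective_algebraMap (algebraMap k K).injective
  have : Algebra.EssFiniteType K L := .of_comp k K L
  have : Algebra.FormallySmooth B K := .of_isLocalization (nonZeroDivisors B)
  exact .comp B K L

/-- A vector `u` that is killed by the differentials at `η` of all polynomial relations among the
`η j` is the image of `η` under a derivation. It gives a derivation on the subalgebra that the `η j`
generate, and this one extends in characteristic zero. -/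
theorem exists_derivation_of_forall_relation {k L n : Type*} [Field k] [CharZero k] [Field L]
    [Algebra k L] [Algebra.EssFiniteType k L] [Fintype n] (η u : n → L)
    (hu : ∀ F : MvPolynomial n k, aeval η F = 0 → ∑ j, aeval η (pderiv j F) * u j = 0) :
    ∃ D : Derivation k L L, ∀ j, D (η j) = u j := by
  classical
  let B := (aeval (R := k) η).range
  let q : MvPolynomial n k →ₐ[k] B := (aeval η).rangeRestrict
  have hq : Function.Surjective q := AlgHom.rangeRestrict_surjective _
  let E : MvPolynomial n k →ₗ[k] L :=
    ∑ j, (LinearMap.mulRight k (u j)) ∘ₗ (aeval η).toLinearMap ∘ₗ (pderiv j).toLinearMap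
  have hE : ∀ F, E F = ∑ j, aeval η (pderiv j F) * u j := fun F => by simp [E]
  have hmul : ∀ F G, E (F * G) = aeval η F * E G + aeval η G * E F := by
    intro F G
    simp only [hE, Derivation.leibniz, map_add, smul_eq_mul, map_mul, add_mul,
      Finset.sum_add_distrib, Finset.mul_sum, mul_assoc]
  have hval : ∀ F, ((q F : B) : L) = aeval η F := fun F => rfl
  have hE_eq : ∀ F G, q F = q G → E F = E G := by
    intro F G h
    rw [← sub_eq_zero, ← map_sub, hE]
    refine hu _ ?_
    rw [map_sub, ← hval, ← hval, h, sub_self]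
  obtain ⟨g, hg⟩ := hq.hasRightInverse
  let d : Derivation k B L := Derivation.mk'
    { toFun := fun b => E (g b)
      map_add' := fun a b => by
        rw [← map_add]; exact hE_eq _ _ (by rw [map_add, hg, hg, hg])
      map_smul' := fun c b => by
        rw [RingHom.id_apply, ← map_smul]; exact hE_eq _ _ (by rw [map_smul, hg, hg]) }
    (fun a b => by
      change E (g (a * b)) = (a : L) * E (g b) + (b : L) * E (g a)
      rw [hE_eq (g (a * b)) (g a * g b) (by rw [map_mul, hg, hg, hg]), hmul, ← hval, ← hval,
        hg, hg])
  have hd : ∀ F, d (q F) = E F := fun F => hE_eq _ _ (hg _)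
  have : Algebra.FormallySmooth B L := formallySmooth_of_charZero (k := k)
  obtain ⟨D, hD⟩ := exists_derivation_extension d
  refine ⟨D, fun j => ?_⟩
  have h1 : η j = algebraMap B L (q (X j)) := by
    change η j = aeval η (X j)
    rw [aeval_X]
  rw [h1, hD, hd, hE, Finset.sum_eq_single j]
  · simp
  · intro b _ hb
    simp [pderiv_X, hb.symm]
  · simp

end Derivations

/-! ### Tangent spaces in affine space and generic smoothness of the addition map -/

section AffineTangent

/-- The tangent space at `p` of the Zariski closure of `S` in affine space, as a space of vectors:
the common kernel of the differentials at `p` of all polynomials that vanish on `S`. -/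
def coneTangent {k n : Type*} [Field k] [Fintype n] (S : Set (n → k)) (p : n → k) :
    Submodule k (n → k) where
  carrier := {v | ∀ F : MvPolynomial n k, (∀ x ∈ S, eval x F = 0) →
    ∑ j, eval p (pderiv j F) * v j = 0}
  zero_mem' := by
    intro F _
    simp
  add_mem' := by
    intro v w hv hw F hF
    simp only [Pi.add_apply, mul_add, Finset.sum_add_distrib]
    rw [hv F hF, hw F hF, add_zero]
  smul_mem' := by
    intro c v hv F hF
    simp only [Pi.smul_apply, smul_eq_mul, mul_left_comm _ c, ← Finset.mul_sum]
    rw [hv F hF, mul_zero]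

/-- For a set `T` of linear functionals on `L ^ n` there is a projection of `L ^ n` onto their common
kernel. Here `π c` is the image of the `c`-th unit vector, and `1 - π` factors through the
functionals. -/
theorem exists_projection_onto_kernel {L n : Type*} [Field L] [Fintype n] [DecidableEq n]
    (T : Set (n → L)) : ∃ π : n → n → L, (∀ c, ∀ r ∈ T, ∑ b, r b * π c b = 0) ∧
      ∀ b, (fun c => (Pi.single b 1 : n → L) c - π c b) ∈ Submodule.span L T := by
  let e := dotProductEquiv L n
  let P : Submodule L (Module.Dual L (n → L)) := (Submodule.span L T).map e.toLinearMap
  let K := P.dualCoannihilator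
  obtain ⟨g, hg⟩ := LinearMap.exists_leftInverse_of_injective K.subtype (by simp)
  refine ⟨fun c => (g (Pi.single c 1) : n → L), fun c r hr => ?_, fun b => ?_⟩
  · exact (Submodule.mem_dualCoannihilator _).1 (g (Pi.single c 1)).2 (e r)
      (Submodule.mem_map_of_mem (Submodule.subset_span hr))
  · let φ : Module.Dual L (n → L) := LinearMap.proj b ∘ₗ (LinearMap.id - K.subtype ∘ₗ g)
    have hφ : φ ∈ K.dualAnnihilator := by
      rw [Submodule.mem_dualAnnihilator]
      intro w hw
      have : g w = ⟨w, hw⟩ := LinearMap.congr_fun hg ⟨w, hw⟩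
      simp [φ, this]
    rw [Subspace.dualCoannihilator_dualAnnihilator_eq] at hφ
    obtain ⟨r, hr, hrφ⟩ := hφ
    suffices h : (fun c => (Pi.single b 1 : n → L) c - (g (Pi.single c 1) : n → L) b) = r from
      h ▸ hr
    funext c
    have := LinearMap.congr_fun hrφ (Pi.single c 1)
    simp [e, φ] at this
    rw [this, Pi.single_comm]

variable {k τ n : Type*} [Field k] [Fintype τ] [Fintype n]

/-- The `τ`-fold power of `C ⊆ k ^ n`, as a subset of `k ^ (τ × n)`. -/
def power (τ : Type*) (C : Set (n → k)) : Set (τ × n → k) := {x | ∀ i, (fun j => x (i, j)) ∈ C}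

/-- The set of the sums of `τ`-tuples of elements of `C`. -/
def sums (τ : Type*) [Fintype τ] (C : Set (n → k)) : Set (n → k) :=
  (fun x j => ∑ i : τ, x (i, j)) '' power τ C

/-- The composite of `F` with `z ↦ a • z + y`, and its differential. -/
theorem exists_affine_substitution (a : k) (y : n → k) (F : MvPolynomial n k) :
    ∃ G : MvPolynomial n k, (∀ z, eval z G = eval (a • z + y) F) ∧
      ∀ z j, eval z (pderiv j G) = a * eval (a • z + y) (pderiv j F) := by
  classical
  let T : MvPolynomial n k →ₐ[k] MvPolynomial n k :=
    aeval fun j => MvPolynomial.C a * X j + MvPolynomial.C (y j)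
  have hT : ∀ z F, eval z (T F) = eval (a • z + y) F := by
    intro z F
    have : (aeval z).comp T = aeval (R := k) (a • z + y) := by
      ext j; simp [T]
    simpa [aeval_eq_eval] using AlgHom.congr_fun this F
  refine ⟨T F, fun z => hT z F, fun z j => ?_⟩
  rw [derivation_aeval, Finset.sum_eq_single j]
  · rw [map_add, pderiv_C, add_zero, pderiv_C_mul, pderiv_X_self, smul_eq_mul, mul_one, eval_mul,
      eval_C, mul_comm]
    congr 1
    exact hT z _
  · intro b _ hb
    simp [pderiv_X, hb.symm]
  · simp

/-- The differential of a polynomial composed with a homothety is a multiple of its differential at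
the image point. -/
theorem coneTangent_le_coneTangent_smul {S : Set (n → k)} {c : k} (hc : c ≠ 0)
    (hS : ∀ x ∈ S, c • x ∈ S) (p : n → k) : coneTangent S p ≤ coneTangent S (c • p) := by
  intro v hv F hF
  obtain ⟨G, hG, hG'⟩ := exists_affine_substitution c 0 F
  have h := hv G fun x hx => by rw [hG, add_zero]; exact hF _ (hS x hx)
  simp only [hG', add_zero, mul_assoc, ← Finset.mul_sum] at h
  exact (mul_eq_zero.1 h).resolve_left hc

theorem coneTangent_smul {S : Set (n → k)} {c : k} (hc : c ≠ 0)
    (hS : ∀ c : k, ∀ x ∈ S, c • x ∈ S) (p : n → k) : coneTangent S (c • p) = coneTangent S p := by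
  refine le_antisymm ?_ (coneTangent_le_coneTangent_smul hc (hS c) p)
  simpa [smul_smul, hc] using
    coneTangent_le_coneTangent_smul (inv_ne_zero hc) (hS c⁻¹) (c • p)

theorem coneTangent_congr {S S' : Set (n → k)}
    (h : ∀ F : MvPolynomial n k, (∀ x ∈ S, eval x F = 0) ↔ ∀ x ∈ S', eval x F = 0) (p : n → k) :
    coneTangent S p = coneTangent S' p := by
  ext v
  exact forall_congr' fun F => by rw [h F]

theorem exists_polynomial_comp {σ : Type*} (φ : (n → k) →ₗ[k] (σ → k)) (c : σ → k)
    (F : MvPolynomial σ k) : ∃ G : MvPolynomial n k, ∀ x, eval x G = eval (φ x + c) F := by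
  classical
  refine ⟨aeval (fun i => ∑ j, MvPolynomial.C (φ (Pi.single j 1) i) * X j + MvPolynomial.C (c i)) F,
    fun x => ?_⟩
  rw [← coe_aeval_eq_eval, RingHom.coe_coe, comp_aeval_apply, aeval_eq_eval]
  congr 2
  ext i
  have h : φ x i = ∑ j, φ (Pi.single j 1) i * x j := by
    conv_lhs => rw [pi_eq_sum_univ' x, map_sum, Finset.sum_apply]
    exact Finset.sum_congr rfl fun j _ => by rw [map_smul, Pi.smul_apply, smul_eq_mul, mul_comm]
  simp [h]

/-- The product of irreducible sets is irreducible: two non-empty open sets meet, since a point of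
one can be moved to a point of the other by changing one factor at a time. -/
theorem isPrime_vanishingIdeal_power {C : Set (n → k)} (hC : (vanishingIdeal k C).IsPrime) :
    (vanishingIdeal k (power τ C)).IsPrime := by
  classical
  have hprime : ∀ F G : MvPolynomial n k, (∃ x ∈ C, eval x F ≠ 0) → (∃ x ∈ C, eval x G ≠ 0) →
      ∃ x ∈ C, eval x F ≠ 0 ∧ eval x G ≠ 0 := by
    rintro F G ⟨x, hx, hxF⟩ ⟨y, hy, hyG⟩
    by_contra! h
    rcases hC.mem_or_mem (x := F) (y := G) (mem_vanishingIdeal_iff.2 fun z hz => by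
      rw [map_mul, aeval_eq_eval]
      by_cases h0 : eval z F = 0
      · rw [h0, zero_mul]
      · rw [h z hz h0, mul_zero]) with h1 | h1
    · exact hxF (mem_vanishingIdeal_iff.1 h1 x hx)
    · exact hyG (mem_vanishingIdeal_iff.1 h1 y hy)
  -- `T` bounds the set of factors in which `x` and `y` differ
  have key : ∀ (T : Finset τ) (F G : MvPolynomial (τ × n) k), ∀ x ∈ power τ C, ∀ y ∈ power τ C,
      (∀ i ∉ T, ∀ j, x (i, j) = y (i, j)) → eval x F ≠ 0 → eval y G ≠ 0 →
      ∃ z ∈ power τ C, eval z F ≠ 0 ∧ eval z G ≠ 0 := by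
    intro T
    induction T using Finset.induction_on with
    | empty =>
      intro F G x hx y _ hxy hF hG
      obtain rfl : x = y := funext fun ij => hxy ij.1 (by simp) ij.2
      exact ⟨x, hx, hF, hG⟩
    | insert i T _ ih =>
      intro F G x hx y hy hxy hF hG
      let φ : (n → k) →ₗ[k] (τ × n → k) :=
        LinearMap.pi fun ij => if ij.1 = i then LinearMap.proj ij.2 else 0
      -- `r x v` is `x` with the `i`-th factor replaced by `v`
      let r : (τ × n → k) → (n → k) → τ × n → k := fun x v ij => if ij.1 = i then v ij.2 else x ij
      have hr : ∀ x v, φ v + (fun ij => if ij.1 = i then 0 else x ij) = r x v := by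
        intro x v
        ext ij
        by_cases h : ij.1 = i <;> simp [φ, r, h]
      have hr_self : ∀ x, r x (fun j => x (i, j)) = x := by
        intro x
        ext ⟨l, j⟩
        by_cases h : l = i
        · simp [r, h]
        · simp [r, h]
      have hr_mem : ∀ x ∈ power τ C, ∀ v ∈ C, r x v ∈ power τ C := by
        intro x hx v hv l
        by_cases h : l = i
        · simpa [r, h] using hv
        · simpa [r, h] using hx l
      obtain ⟨F', hF'⟩ := exists_polynomial_comp φ (fun ij => if ij.1 = i then 0 else x ij) F
      obtain ⟨G', hG'⟩ := exists_polynomial_comp φ (fun ij => if ij.1 = i then 0 else y ij) G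
      obtain ⟨v, hv, hvF, hvG⟩ := hprime F' G'
        ⟨_, hx i, by rwa [hF', hr, hr_self]⟩ ⟨_, hy i, by rwa [hG', hr, hr_self]⟩
      rw [hF', hr] at hvF
      rw [hG', hr] at hvG
      refine ih F G _ (hr_mem x hx v hv) _ (hr_mem y hy v hv) (fun l hl j => ?_) hvF hvG
      by_cases h : l = i
      · simp [r, h]
      · simpa [r, h] using hxy l (by simp [h, hl]) j
  obtain ⟨x₀, hx₀⟩ : C.Nonempty := by
    by_contra h
    rw [Set.not_nonempty_iff_eq_empty] at h
    exact hC.ne_top (by rw [h, vanishingIdeal_empty])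
  refine ⟨fun h => ?_, fun {F G} hFG => ?_⟩
  · rw [Ideal.eq_top_iff_one, mem_vanishingIdeal_iff] at h
    simpa using h (fun ij => x₀ ij.2) fun i => hx₀
  · by_contra! h
    simp only [mem_vanishingIdeal_iff, not_forall] at h
    obtain ⟨⟨x, hx, hxF⟩, y, hy, hyG⟩ := h
    obtain ⟨z, hz, hzF, hzG⟩ := key Finset.univ F G x hx y hy (by simp) hxF hyG
    have := mem_vanishingIdeal_iff.1 hFG z hz
    rw [map_mul] at this
    exact mul_ne_zero hzF hzG this

/-- The easy half of Terracini's lemma, valid at every point. -/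
theorem coneTangent_le_coneTangent_sums {C : Set (n → k)} {x : τ × n → k} (hx : x ∈ power τ C)
    (i : τ) : coneTangent C (fun j => x (i, j)) ≤
      coneTangent (sums τ C) (fun j => ∑ i, x (i, j)) := by
  classical
  intro v hv F hF
  -- the translate of `F` by the sum of the other points vanishes on `C`
  let y : n → k := fun j => ∑ l ∈ Finset.univ.erase i, x (l, j)
  obtain ⟨G, hG, hG'⟩ := exists_affine_substitution 1 y F
  have hsum : (1 : k) • (fun j => x (i, j)) + y = fun j => ∑ l, x (l, j) := by
    rw [one_smul]
    exact funext fun j => Finset.add_sum_erase _ (fun l => x (l, j)) (Finset.mem_univ i)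
  have h := hv G fun z hz => by
    rw [hG]
    refine hF _ ⟨fun lj => if lj.1 = i then z lj.2 else x lj, fun l => ?_, ?_⟩
    · by_cases h : l = i
      · simpa [h] using hz
      · simpa [h] using hx l
    · ext j
      change ∑ l, (if l = i then z j else x (l, j)) = ((1 : k) • z + y) j
      rw [← Finset.add_sum_erase _ _ (Finset.mem_univ i), one_smul, Pi.add_apply]
      simp only [if_true, y]
      congr 1
      refine Finset.sum_congr rfl fun l hl => ?_
      rw [if_neg (Finset.ne_of_mem_erase hl)]
  simpa only [hG', hsum, one_mul] using h

/-- A vector over `L` that is tangent at `∑ i, ξ i` to the set of sums is a sum of vectors that are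
tangent to `C` at the `ξ i`, provided that the polynomials that vanish on the power of `C` are
exactly the relations among the coordinates of `ξ`, i.e. `ξ` is the generic point. -/
theorem exists_tangent_vectors_of_generic {L : Type*} [CharZero k] [Field L] [Algebra k L]
    [Algebra.EssFiniteType k L] {C : Set (n → k)} (ξ : τ × n → L)
    (hξ : ∀ F : MvPolynomial (τ × n) k, aeval ξ F = 0 ↔ ∀ x ∈ power τ C, eval x F = 0)
    (u : n → L) (hu : ∀ F : MvPolynomial n k, (∀ x ∈ sums τ C, eval x F = 0) →
      ∑ j, aeval (fun j => ∑ i, ξ (i, j)) (pderiv j F) * u j = 0) :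
    ∃ w : τ → n → L, (∀ j, ∑ i, w i j = u j) ∧ ∀ i, ∀ G : MvPolynomial n k,
      (∀ x ∈ C, eval x G = 0) → ∑ j, aeval (fun j => ξ (i, j)) (pderiv j G) * w i j = 0 := by
  obtain ⟨D, hD⟩ := exists_derivation_of_forall_relation (k := k) (fun j => ∑ i, ξ (i, j)) u
    fun F hF => hu F fun x hx => by
      obtain ⟨y, hy, rfl⟩ := hx
      have h := (hξ (aeval (fun j => ∑ i, X (i, j)) F)).1 (by
        rw [comp_aeval_apply]; simpa using hF) y hy
      rw [← coe_aeval_eq_eval, RingHom.coe_coe, comp_aeval_apply] at h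
      simp only [map_sum, aeval_X] at h
      rw [← coe_aeval_eq_eval, RingHom.coe_coe]
      exact h
  refine ⟨fun i j => D (ξ (i, j)), fun j => by rw [← hD, map_sum], fun i G hG => ?_⟩
  have h0 : aeval (fun j => ξ (i, j)) G = 0 := by
    have h := (hξ (rename (Prod.mk i) G)).2 fun x hx => by
      rw [eval_rename]; exact hG _ (hx i)
    rwa [aeval_rename] at h
  have := derivation_aeval D (fun j => ξ (i, j)) G
  rw [h0, map_zero] at this
  simpa using this.symm

/-- Finitely many vectors in the span of `T` over the fraction field `L` have a common denominator
`z`: multiplied by it they lie in the span of `T` over the ring `A`. -/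
theorem exists_common_denominator {A L n : Type*} [CommRing A] [IsDomain A] [Field L] [Algebra A L]
    [IsFractionRing A L] [Fintype n] (T : Set (n → A)) (r : n → n → L)
    (hr : ∀ b, r b ∈ Submodule.span L ((fun f j => algebraMap A L (f j)) '' T)) :
    ∃ z : A, z ≠ 0 ∧ ∀ b, ∃ y ∈ Submodule.span A T, ∀ c,
      algebraMap A L z * r b c = algebraMap A L (y c) := by
  classical
  let φ : (n → A) →ₗ[A] (n → L) := (Algebra.linearMap A L).compLeft n
  have hφ : (fun (f : n → A) j => algebraMap A L (f j)) = φ := rfl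
  have h : ∀ b, ∃ z : A, z ≠ 0 ∧ ∃ y ∈ Submodule.span A T, z • r b = φ y := by
    intro b
    obtain ⟨y, hy, z, hz⟩ := (IsLocalization.mem_span_iff (nonZeroDivisors A)).1 (hr b)
    rw [hφ, Submodule.span_image] at hy
    obtain ⟨y', hy', rfl⟩ := hy
    refine ⟨z, nonZeroDivisors.ne_zero z.2, y', hy', ?_⟩
    rw [hz, ← algebraMap_smul L (z : A), smul_smul, mul_comm, IsLocalization.mk'_spec, map_one,
      one_smul]
  choose z hz y hy hzy using h
  refine ⟨∏ b, z b, Finset.prod_ne_zero_iff.2 fun b _ => hz b, fun b =>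
    ⟨(∏ b' ∈ Finset.univ.erase b, z b') • y b, Submodule.smul_mem _ _ (hy b), fun c => ?_⟩⟩
  have h := congrFun (hzy b) c
  rw [← Finset.mul_prod_erase _ _ (Finset.mem_univ b), Pi.smul_apply, smul_eq_mul, map_mul, map_mul,
    mul_comm (algebraMap A L (z b)), mul_assoc]
  congr 1
  simpa [φ, Algebra.smul_def] using h

/-- **Terracini's lemma, affine form.** If the power of `C` is irreducible, then at a generic point
of it the tangent space of the set of sums is contained in the sum of the tangent spaces of `C`. -/
theorem exists_coneTangent_sums_le [CharZero k] {C : Set (n → k)}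
    (hprime : (vanishingIdeal k (power τ C)).IsPrime) :
    ∃ f, f ∉ vanishingIdeal k (power τ C) ∧ ∀ x ∈ power τ C, eval x f ≠ 0 →
      coneTangent (sums τ C) (fun j => ∑ i, x (i, j)) ≤
        ⨆ i, coneTangent C (fun j => x (i, j)) := by
  classical
  let J := vanishingIdeal k (power τ C)
  let A := MvPolynomial (τ × n) k ⧸ J
  let L := FractionRing A
  let ξ : τ × n → A := fun ij => Ideal.Quotient.mkₐ k J (X ij)
  have hξA : ∀ F : MvPolynomial (τ × n) k, aeval ξ F = Ideal.Quotient.mkₐ k J F := by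
    intro F
    rw [← comp_aeval_apply, aeval_X_left_apply]
  have hinj : Function.Injective (algebraMap A L) := IsFractionRing.injective A L
  have hval : ∀ (y : n → A) (F : MvPolynomial n k),
      aeval (fun j => algebraMap A L (y j)) F = algebraMap A L (aeval y F) :=
    fun y F => aeval_algebraMap_apply L y F
  -- the rows of the Jacobian matrix of the set of sums at its generic point
  let T : Set (n → A) := {r | ∃ F : MvPolynomial n k, (∀ x ∈ sums τ C, eval x F = 0) ∧
    r = fun j => aeval (fun j => ∑ i, ξ (i, j)) (pderiv j F)}
  -- a projection of `L ^ n` onto the tangent space there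
  obtain ⟨π, hπ, hrow⟩ := exists_projection_onto_kernel
    ((fun f j => algebraMap A L (f j)) '' T)
  have : Algebra.EssFiniteType A L := .of_isLocalization L (nonZeroDivisors A)
  have : Algebra.EssFiniteType k L := .comp k A L
  have hw : ∀ c, ∃ w : τ → n → L, (∀ j, ∑ i, w i j = π c j) ∧ ∀ i, ∀ G : MvPolynomial n k,
      (∀ x ∈ C, eval x G = 0) →
        ∑ j, aeval (fun j => algebraMap A L (ξ (i, j))) (pderiv j G) * w i j = 0 := by
    intro c
    refine exists_tangent_vectors_of_generic (fun ij => algebraMap A L (ξ ij)) (fun F => ?_) (π c)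
      fun F hF => ?_
    · rw [show aeval (fun ij => algebraMap A L (ξ ij)) F = algebraMap A L (aeval ξ F) from
        aeval_algebraMap_apply L ξ F, map_eq_zero_iff _ hinj, hξA, Ideal.Quotient.mkₐ_eq_mk,
        Ideal.Quotient.eq_zero_iff_mem, mem_vanishingIdeal_iff]
      rfl
    · have := hπ c _ ⟨_, ⟨F, hF, rfl⟩, rfl⟩
      simpa only [← map_sum, hval] using this
  choose w hwsum hwT using hw
  obtain ⟨z₁, hz₁, hy⟩ := exists_common_denominator T _ hrow
  choose y hyT hyz using hy
  obtain ⟨z₂, hz₂⟩ := IsLocalization.exist_integer_multiples_of_finite (nonZeroDivisors A)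
    (fun a : n × τ × n => w a.1 a.2.1 a.2.2)
  choose w' hw' using hz₂
  obtain ⟨f, hf⟩ := Ideal.Quotient.mkₐ_surjective k J (z₁ * z₂)
  -- the identity `1 = (1 - π) + π`, multiplied by the common denominator `z₁ * z₂`
  have hid : ∀ b c, z₁ * (z₂ : A) * (Pi.single b 1 : n → A) c =
      z₂ * y b c + ∑ i, z₁ * w' (c, i, b) := by
    intro b c
    apply hinj
    have h1 := hyz b c
    have h2 : ∀ i, algebraMap A L (w' (c, i, b)) = algebraMap A L z₂ * w c i b := fun i => by
      rw [hw']; simp [Algebra.smul_def]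
    have h3 : algebraMap A L ((Pi.single b 1 : n → A) c) = (Pi.single b 1 : n → L) c := by
      by_cases h : c = b
      · subst h; simp
      · simp [h]
    simp only [map_add, map_mul, map_sum, ← h1, h2, h3, ← hwsum, ← Finset.mul_sum]
    ring
  have hw'T : ∀ c i, ∀ G : MvPolynomial n k, (∀ x ∈ C, eval x G = 0) →
      ∑ j, aeval (fun j => ξ (i, j)) (pderiv j G) * w' (c, i, j) = 0 := by
    intro c i G hG
    apply hinj
    have h2 : ∀ j, algebraMap A L (w' (c, i, j)) = algebraMap A L z₂ * w c i j := fun i => by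
      rw [hw']; simp [Algebra.smul_def]
    simp only [map_sum, map_mul, h2, ← hval, mul_left_comm _ (algebraMap A L z₂), ← Finset.mul_sum,
      hwT c i G hG, mul_zero, map_zero]
  refine ⟨f, fun hfJ => ?_, fun x hx hfx v hv => ?_⟩
  · have h0 : Ideal.Quotient.mkₐ k J f = 0 := Ideal.Quotient.eq_zero_iff_mem.2 hfJ
    rw [hf] at h0
    exact mul_ne_zero hz₁ (nonZeroDivisors.ne_zero z₂.2) h0
  -- specialize the identity `hid` at the point `x`
  let ev : A →ₐ[k] k := Ideal.Quotient.liftₐ J (aeval x) fun F hF =>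
    (mem_vanishingIdeal_iff.1 hF) x hx
  have hevξ : ∀ ij, ev (ξ ij) = x ij := fun ij => by
    change aeval x (X ij) = x ij
    simp
  have hev : ∀ (y : n → A) (F : MvPolynomial n k),
      ev (aeval y F) = eval (fun j => ev (y j)) F := by
    intro y F
    rw [comp_aeval_apply]; rfl
  have hevy : ∀ b, ∑ c, ev (y b c) * v c = 0 := by
    intro b
    refine Submodule.span_induction (p := fun r _ => ∑ c, ev (r c) * v c = 0) ?_ ?_ ?_ ?_ (hyT b)
    · rintro r ⟨F, hF, rfl⟩
      simpa only [hev, map_sum, hevξ] using hv F hF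
    · simp
    · intro r r' _ _ hr hr'
      simp only [Pi.add_apply, map_add, add_mul, Finset.sum_add_distrib, hr, hr', add_zero]
    · intro a r _ hr
      simp only [Pi.smul_apply, smul_eq_mul, map_mul, mul_assoc, ← Finset.mul_sum, hr, mul_zero]
  have hfx' : ev z₁ * ev z₂ = eval x f := by
    rw [← map_mul, ← hf]; rfl
  have hv_eq : eval x f • v = ∑ i, ∑ c, (ev z₁ * v c) • fun j => ev (w' (c, i, j)) := by
    ext b
    have h := congrArg (fun r : n → A => ∑ c, ev (r c) * v c) (funext (hid b))
    simp only [map_add, map_mul, map_sum, add_mul, Finset.sum_add_distrib, mul_assoc,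
      ← Finset.mul_sum, hevy, mul_zero, zero_add] at h
    rw [Finset.sum_eq_single b (fun c _ hc => by simp [hc]) (by simp)] at h
    simp only [Pi.single_eq_same, map_one, one_mul, ← mul_assoc, hfx'] at h
    rw [Pi.smul_apply, smul_eq_mul, h, Finset.sum_comm]
    simp only [Finset.sum_apply, Pi.smul_apply, smul_eq_mul, Finset.sum_mul, Finset.mul_sum]
    refine Finset.sum_congr rfl fun c _ => Finset.sum_congr rfl fun i _ => by ring
  rw [← Submodule.smul_mem_iff _ hfx, hv_eq]
  refine Submodule.sum_mem _ fun i _ => Submodule.mem_iSup_of_mem i ?_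
  refine Submodule.sum_mem _ fun c _ => Submodule.smul_mem _ _ fun G hG => ?_
  have h := congrArg ev (hw'T c i G hG)
  simpa only [map_sum, map_mul, hev, hevξ, map_zero] using h

end AffineTangent

/-! ### Affine cones and the Zariski topology -/

section Cones

variable {k : Type*} [Field k] {N : ℕ}

/-- The affine cone over a set of points of projective space, including the zero vector. -/
def cone (X : Set (PP k N)) : Set (Fin (N + 1) → k) :=
  {v | ∀ h : v ≠ 0, Projectivization.mk k v h ∈ X}

theorem smul_mem_cone {X : Set (PP k N)} (c : k) {v : Fin (N + 1) → k} (hv : v ∈ cone X) :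
    c • v ∈ cone X := by
  intro h
  have hv0 : v ≠ 0 := right_ne_zero_of_smul h
  have : Projectivization.mk k (c • v) h = Projectivization.mk k v hv0 :=
    (Projectivization.mk_eq_mk_iff' k _ _ _ _).2 ⟨c, rfl⟩
  rw [this]
  exact hv hv0

theorem rep_mem_cone {X : Set (PP k N)} {P : PP k N} (hP : P ∈ X) : P.rep ∈ cone X := by
  intro h
  rwa [Projectivization.mk_rep]

theorem eval_eq_zero_of_mem_cone {X : Set (PP k N)} (hX : X.Nonempty)
    {F : MvPolynomial (Fin (N + 1)) k} {d : ℕ} (hF : F.IsHomogeneous d)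
    (h : ∀ R ∈ X, VanishesAt F R) {v : Fin (N + 1) → k} (hv : v ∈ cone X) : eval v F = 0 := by
  by_cases hv0 : v = 0
  · -- a form of degree `0` that vanishes at some point vanishes at the origin, too
    obtain ⟨P, hP⟩ := hX
    have h0 : eval P.rep F = 0 := h P hP
    rw [hv0, ← zero_smul k P.rep, eval_smul_of_isHomogeneous hF, h0, mul_zero]
  · exact (vanishesAt_mk_iff hF v hv0).1 (h _ (hv hv0))

/-- If a polynomial vanishes on a set of vectors that is stable under scaling, then its homogeneous
components are forms that vanish there. -/
theorem eval_component_eq_zero [Infinite k] {S : Set (Fin (N + 1) → k)}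
    (hS : ∀ c : k, ∀ x ∈ S, c • x ∈ S) {F : MvPolynomial (Fin (N + 1)) k}
    (hF : ∀ x ∈ S, eval x F = 0) (e : Unit →₀ ℕ) {x : Fin (N + 1) → k} (hx : x ∈ S) :
    eval x (groupComponent (fun _ => ()) e F) = 0 :=
  eval_groupComponent_eq_zero (fun x hx t => hS (t ()) x hx) hF e hx

theorem affineTangentSpace_eq_coneTangent [Infinite k] {X : Set (PP k N)} (hX : X.Nonempty)
    (P : PP k N) : affineTangentSpace X P = coneTangent (cone X) P.rep := by
  refine le_antisymm (fun v hv F hF => ?_) fun v hv F d hF h =>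
    hv F fun x hx => eval_eq_zero_of_mem_cone hX hF h hx
  let φ : MvPolynomial (Fin (N + 1)) k →ₗ[k] k :=
    ∑ j, (LinearMap.mulRight k (v j)) ∘ₗ (aeval P.rep).toLinearMap ∘ₗ (pderiv j).toLinearMap
  have hφ : ∀ F, φ F = ∑ j, eval P.rep (pderiv j F) * v j := fun F => by
    simp [φ, aeval_eq_eval]
  rw [← hφ]
  refine mem_of_forall_groupComponent_mem (g := fun _ => ()) (LinearMap.ker φ) fun e => ?_
  rw [LinearMap.mem_ker, hφ]
  exact hv _ _ (isHomogeneous_groupComponent e F) fun R hR =>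
    eval_component_eq_zero (fun c x => smul_mem_cone c) hF e (rep_mem_cone hR)

theorem isClosed_setOf_vanishesAt {F : MvPolynomial (Fin (N + 1)) k} {d : ℕ}
    (hF : F.IsHomogeneous d) : IsClosed[zariski k N] {P | VanishesAt F P} := by
  let := zariski k N
  rw [← isOpen_compl_iff]
  exact TopologicalSpace.isOpen_generateFrom_of_mem ⟨F, d, hF, rfl⟩

theorem mk_mem_span_range_iff {ι : Type*} {P : ι → PP k N} {v : Fin (N + 1) → k} (hv : v ≠ 0) :
    Projectivization.mk k v hv ∈ Projectivization.Subspace.span (Set.range P) ↔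
      v ∈ Submodule.span k (Set.range fun i => (P i).rep) := by
  have h : Projectivization.Subspace.span (Set.range P) =
      (Submodule.span k (Set.range fun i => (P i).rep)).projectivization := by
    apply le_antisymm
    · rw [Projectivization.Subspace.span_le_subspace_iff]
      rintro _ ⟨i, rfl⟩
      rw [← Projectivization.mk_rep (P i)]
      exact (Submodule.mk_mem_projectivization_iff _ (P i).rep_nonzero).2
        (Submodule.subset_span ⟨i, rfl⟩)
    · rw [← OrderIso.le_symm_apply, Submodule.span_le]
      rintro _ ⟨i, rfl⟩
      refine (Projectivization.Subspace.mem_submodule_iff _ (P i).rep_nonzero).2 ?_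
      rw [Projectivization.mk_rep]
      exact Projectivization.Subspace.subset_span _ ⟨i, rfl⟩
  rw [h, Submodule.mk_mem_projectivization_iff]

theorem smul_mem_sums {X : Set (PP k N)} {s : ℕ} (c : k) {v : Fin (N + 1) → k}
    (hv : v ∈ sums (Fin s) (cone X)) : c • v ∈ sums (Fin s) (cone X) := by
  obtain ⟨x, hx, rfl⟩ := hv
  refine ⟨c • x, fun i => smul_mem_cone c (hx i), ?_⟩
  ext j
  simp [Finset.mul_sum]

theorem secantVariety_nonempty {X : Set (PP k N)} (hX : X.Nonempty) {s : ℕ} (hs : 1 ≤ s) :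
    (secantVariety s X).Nonempty := by
  let := zariski k N
  obtain ⟨P₀, hP₀⟩ := hX
  exact ⟨P₀, subset_closure ⟨fun _ => P₀, fun _ => hP₀,
    Projectivization.Subspace.subset_span _ ⟨⟨0, hs⟩, rfl⟩⟩⟩

/-- The cone over the secant variety is the Zariski closure of the set of sums of `s`-tuples of
elements of the cone over `X`. -/
theorem vanishes_on_cone_secantVariety_iff [Infinite k] {X : Set (PP k N)} (hX : X.Nonempty)
    {s : ℕ} (hs : 1 ≤ s) (F : MvPolynomial (Fin (N + 1)) k) :
    (∀ v ∈ cone (secantVariety s X), eval v F = 0) ↔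
      ∀ v ∈ sums (Fin s) (cone X), eval v F = 0 := by
  let := zariski k N
  constructor
  · rintro h _ ⟨x, hx, rfl⟩
    refine h _ fun hne => subset_closure ?_
    obtain ⟨P₀, hP₀⟩ := hX
    classical
    refine ⟨fun i => if h : (fun j => x (i, j)) ≠ 0 then Projectivization.mk k _ h else P₀,
      fun i => ?_, (mk_mem_span_range_iff hne).2 ?_⟩
    · dsimp only
      split_ifs with h
      · exact hx i h
      · exact hP₀
    · have : (fun (x : Fin s × Fin (N + 1) → k) j => ∑ i, x (i, j)) x =
          ∑ i, fun j => x (i, j) := by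
        ext j; simp
      rw [this]
      refine Submodule.sum_mem _ fun i _ => ?_
      by_cases h : (fun j => x (i, j)) = 0
      · rw [h]; exact Submodule.zero_mem _
      · obtain ⟨a, ha⟩ := Projectivization.exists_smul_eq_mk_rep k _ h
        rw [← Submodule.smul_mem_iff _ a.ne_zero]
        refine Submodule.subset_span ⟨i, ?_⟩
        simp only [ne_eq, h, not_false_eq_true, dite_true]
        exact ha.symm
  · intro h v hv
    have hne := secantVariety_nonempty hX hs
    refine mem_of_forall_groupComponent_mem (g := fun _ => ())
      (LinearMap.ker (aeval (R := k) v).toLinearMap) fun e => ?_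
    have hG := isHomogeneous_groupComponent e F
    refine eval_eq_zero_of_mem_cone hne hG ?_ hv
    refine closure_minimal ?_ (isClosed_setOf_vanishesAt hG)
    rintro Q ⟨P, hP, hQ⟩
    refine eval_component_eq_zero (fun c x => smul_mem_sums c) h e ?_
    rw [← Projectivization.mk_rep Q, mk_mem_span_range_iff,
      Submodule.mem_span_range_iff_exists_fun] at hQ
    obtain ⟨c, hc⟩ := hQ
    refine ⟨fun ij => c ij.1 * (P ij.1).rep ij.2,
      fun i => smul_mem_cone (c i) (rep_mem_cone (hP i)), ?_⟩
    rw [← hc]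
    ext j
    simp

/-- The complements of hypersurfaces form a basis, as their intersections are of the same kind. -/
theorem exists_form_of_mem_isOpen {O : Set (PP k N)} (hO : IsOpen[zariski k N] O) {P : PP k N}
    (hP : P ∈ O) : ∃ (F : MvPolynomial (Fin (N + 1)) k) (d : ℕ), F.IsHomogeneous d ∧
      ¬ VanishesAt F P ∧ ∀ R, ¬ VanishesAt F R → R ∈ O := by
  induction hO with
  | basic U hU =>
    obtain ⟨F, d, hF, rfl⟩ := hU
    exact ⟨F, d, hF, hP, fun R hR => hR⟩
  | univ => exact ⟨1, 0, isHomogeneous_one _ _, by simp [VanishesAt], fun R _ => trivial⟩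
  | inter U V _ _ hU hV =>
    obtain ⟨F, d, hF, hFP, hFU⟩ := hU hP.1
    obtain ⟨G, e, hG, hGP, hGV⟩ := hV hP.2
    refine ⟨F * G, d + e, hF.mul hG, ?_, fun R hR => ?_⟩
    · simpa [VanishesAt] using ⟨hFP, hGP⟩
    · simp only [VanishesAt, map_mul, mul_eq_zero, not_or] at hR
      exact ⟨hFU R hR.1, hGV R hR.2⟩
  | sUnion S _ ih =>
    obtain ⟨U, hU, hPU⟩ := hP
    obtain ⟨F, d, hF, hFP, hFU⟩ := ih U hU hPU
    exact ⟨F, d, hF, hFP, fun R hR => ⟨U, hU, hFU R hR⟩⟩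

theorem IsMultihomogeneous.mul {s : ℕ} {F G : MvPolynomial (Fin s × Fin (N + 1)) k}
    {d e : Fin s → ℕ} (hF : IsMultihomogeneous F d) (hG : IsMultihomogeneous G e) :
    IsMultihomogeneous (F * G) (d + e) := by
  classical
  intro m hm i
  obtain ⟨a, ha, b, hb, rfl⟩ := Finset.mem_add.1 (support_mul F G hm)
  simp only [Finsupp.add_apply, Finset.sum_add_distrib, Pi.add_apply, hF a ha i, hG b hb i]

theorem exists_multihomogeneous_of_mem_isOpen {s : ℕ} {O : Set (Fin s → PP k N)}
    (hO : IsOpen[zariskiPower k N s] O) {P : Fin s → PP k N} (hP : P ∈ O) :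
    ∃ (F : MvPolynomial (Fin s × Fin (N + 1)) k) (d : Fin s → ℕ), IsMultihomogeneous F d ∧
      eval (fun ij => (P ij.1).rep ij.2) F ≠ 0 ∧
      ∀ R : Fin s → PP k N, eval (fun ij => (R ij.1).rep ij.2) F ≠ 0 → R ∈ O := by
  induction hO with
  | basic U hU =>
    obtain ⟨F, d, hF, rfl⟩ := hU
    exact ⟨F, d, hF, hP, fun R hR => hR⟩
  | univ =>
    refine ⟨1, 0, fun m hm i => ?_, by simp, fun R _ => trivial⟩
    rw [support_one, Finset.mem_singleton] at hm
    simp [hm]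
  | inter U V _ _ hU hV =>
    obtain ⟨F, d, hF, hFP, hFU⟩ := hU hP.1
    obtain ⟨G, e, hG, hGP, hGV⟩ := hV hP.2
    refine ⟨F * G, d + e, hF.mul hG, ?_, fun R hR => ?_⟩
    · rw [map_mul]
      exact mul_ne_zero hFP hGP
    · rw [map_mul] at hR
      exact ⟨hFU R (left_ne_zero_of_mul hR), hGV R (right_ne_zero_of_mul hR)⟩
  | sUnion S _ ih =>
    obtain ⟨U, hU, hPU⟩ := hP
    obtain ⟨F, d, hF, hFP, hFU⟩ := ih U hU hPU
    exact ⟨F, d, hF, hFP, fun R hR => ⟨U, hU, hFU R hR⟩⟩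

/-- For any polynomial `f`, the points of `ℙ^N` over which `f` is not identically zero form an open
set: the union of the complements of the zero loci of the homogeneous components of `f`. -/
theorem isOpen_setOf_scalePoly_ne_zero (f : MvPolynomial (Fin (N + 1)) k) :
    IsOpen[zariski k N] {P | scalePoly (fun _ => ()) P.rep f ≠ 0} := by
  let := zariski k N
  simp only [scalePoly_ne_zero_iff_exists_component, Set.ofPred_exists]
  exact isOpen_iUnion fun e => TopologicalSpace.isOpen_generateFrom_of_mem
    ⟨_, _, isHomogeneous_groupComponent e f, rfl⟩

theorem isOpen_setOf_scalePoly_fst_ne_zero {s : ℕ} (f : MvPolynomial (Fin s × Fin (N + 1)) k) :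
    IsOpen[zariskiPower k N s]
      {P | scalePoly Prod.fst (fun ij => (P ij.1).rep ij.2) f ≠ 0} := by
  let := zariskiPower k N s
  simp only [scalePoly_ne_zero_iff_exists_component, Set.ofPred_exists]
  exact isOpen_iUnion fun e => TopologicalSpace.isOpen_generateFrom_of_mem
    ⟨_, _, isMultihomogeneous_groupComponent e f, rfl⟩

/-- Two polynomials that do not vanish on the cone over `X` are not identically zero over non-empty
open subsets of `X`; where these meet, there is a line on which neither vanishes identically. -/
theorem isPrime_vanishingIdeal_cone [Infinite k] {X : Set (PP k N)}
    (hX : @IsIrreducible _ (zariski k N) X) : (vanishingIdeal k (cone X)).IsPrime := by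
  let := zariski k N
  have hcomp : ∀ F, F ∉ vanishingIdeal k (cone X) →
      ∃ P ∈ X, scalePoly (fun _ => ()) P.rep F ≠ 0 := by
    intro F hF
    by_contra! h
    apply hF
    rw [mem_vanishingIdeal_iff]
    intro v hv
    refine mem_of_forall_groupComponent_mem (g := fun _ => ())
      (LinearMap.ker (aeval (R := k) v).toLinearMap) fun e => ?_
    refine eval_eq_zero_of_mem_cone hX.nonempty (isHomogeneous_groupComponent e F) ?_ hv
    intro R hR
    have := h R hR
    rw [VanishesAt, ← coeff_scalePoly, this, coeff_zero]
  refine ⟨fun h => ?_, fun {F G} hFG => ?_⟩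
  · rw [Ideal.eq_top_iff_one, mem_vanishingIdeal_iff] at h
    obtain ⟨P, hP⟩ := hX.nonempty
    simpa using h _ (rep_mem_cone hP)
  · by_contra! h
    obtain ⟨P, hP, hPF⟩ := hcomp F h.1
    obtain ⟨Q, hQ, hQG⟩ := hcomp G h.2
    obtain ⟨R, hR, hRF, hRG⟩ := hX.isPreirreducible _ _ (isOpen_setOf_scalePoly_ne_zero F)
      (isOpen_setOf_scalePoly_ne_zero G) ⟨P, hP, hPF⟩ ⟨Q, hQ, hQG⟩
    have hne : scalePoly (fun _ => ()) R.rep (F * G) ≠ 0 := by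
      rw [map_mul]
      exact mul_ne_zero hRF hRG
    obtain ⟨t, ht⟩ := scalePoly_ne_zero_iff_exists_eval.1 hne
    exact ht (mem_vanishingIdeal_iff.1 hFG _ (smul_mem_cone (t ()) (rep_mem_cone hR)))

/-- Terracini's lemma at a generic point of the power of the cone, where in addition no component
and no sum of components is the zero vector. -/
theorem exists_generic_polynomial [CharZero k] {X : Set (PP k N)}
    (hX : @IsIrreducible _ (zariski k N) X) {s : ℕ} (hs : 1 ≤ s) :
    ∃ f, f ∉ vanishingIdeal k (power (Fin s) (cone X)) ∧
      ∀ x ∈ power (Fin s) (cone X), eval x f ≠ 0 →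
        (∀ i, (fun j => x (i, j)) ≠ 0) ∧ (fun j => ∑ i, x (i, j)) ≠ 0 ∧
        coneTangent (cone (secantVariety s X)) (fun j => ∑ i, x (i, j)) =
          ⨆ i, coneTangent (cone X) (fun j => x (i, j)) := by
  let := zariski k N
  have hJ := isPrime_vanishingIdeal_power (τ := Fin s) (isPrime_vanishingIdeal_cone hX)
  obtain ⟨f, hfJ, hf⟩ := exists_coneTangent_sums_le hJ
  obtain ⟨P, hP⟩ := hX.nonempty
  obtain ⟨c, hc⟩ := Function.ne_iff.1 P.rep_nonzero
  have hmem : (fun ij : Fin s × Fin (N + 1) => P.rep ij.2) ∈ power (Fin s) (cone X) :=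
    fun _ => rep_mem_cone hP
  have h1 : ∏ i : Fin s, (MvPolynomial.X (i, c) : MvPolynomial (Fin s × Fin (N + 1)) k) ∉
      vanishingIdeal k (power (Fin s) (cone X)) := by
    intro h
    have := mem_vanishingIdeal_iff.1 h _ hmem
    rw [map_prod] at this
    obtain ⟨i, -, hi⟩ := Finset.prod_eq_zero_iff.1 this
    exact hc (by simpa using hi)
  have h2 : ∑ i : Fin s, (MvPolynomial.X (i, c) : MvPolynomial (Fin s × Fin (N + 1)) k) ∉
      vanishingIdeal k (power (Fin s) (cone X)) := by
    intro h
    have := mem_vanishingIdeal_iff.1 h _ hmem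
    simp only [map_sum, aeval_X, Finset.sum_const, Finset.card_univ, Fintype.card_fin,
      nsmul_eq_mul, mul_eq_zero, Nat.cast_eq_zero] at this
    rcases this with h | h
    · omega
    · exact hc h
  -- the second factor vanishes as soon as a component or the sum of the components is zero
  refine ⟨f * ((∏ i, MvPolynomial.X (i, c)) * ∑ i, MvPolynomial.X (i, c)), fun h => ?_,
    fun x hx hxf => ?_⟩
  · rcases hJ.mem_or_mem h with h | h
    · exact hfJ h
    · exact (hJ.mem_or_mem h).elim h1 h2
  · simp only [map_mul, map_prod, map_sum, eval_X] at hxf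
    refine ⟨fun i h => ?_, fun h => ?_, ?_⟩
    · exact Finset.prod_ne_zero_iff.1 (left_ne_zero_of_mul (right_ne_zero_of_mul hxf)) i
        (Finset.mem_univ i) (congrFun h c)
    · exact right_ne_zero_of_mul (right_ne_zero_of_mul hxf) (congrFun h c)
    · rw [coneTangent_congr (vanishes_on_cone_secantVariety_iff hX.nonempty hs)]
      exact le_antisymm (hf x hx (left_ne_zero_of_mul hxf))
        (iSup_le fun i => coneTangent_le_coneTangent_sums hx i)

end Cones

/-! ### Generic tuples of points and generic points of their span -/

section Genericity

variable {k : Type*} [Field k] {N : ℕ}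

/-- A linear choice of preimages on the range of a linear map, extended to the whole space. -/
theorem exists_idempotent_section {k V W : Type*} [Field k] [AddCommGroup V] [Module k V]
    [AddCommGroup W] [Module k W] (B : V →ₗ[k] W) :
    ∃ l : W →ₗ[k] V, ∀ v, B (l (B v)) = B v := by
  obtain ⟨g, hg⟩ := LinearMap.exists_rightInverse_of_surjective B.rangeRestrict B.range_rangeRestrict
  obtain ⟨l, hl⟩ := LinearMap.exists_extend g
  refine ⟨l, fun v => ?_⟩
  have h1 : l (B v) = g ⟨B v, v, rfl⟩ := LinearMap.congr_fun hl ⟨B v, v, rfl⟩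
  rw [h1]
  exact congrArg Subtype.val (LinearMap.congr_fun hg ⟨B v, v, rfl⟩)

/-- Non-vanishing of a polynomial on the power of a cone is a generic condition. -/
theorem subset_closure_scalePoly_fst_ne_zero [Infinite k] {X : Set (PP k N)} {s : ℕ}
    {f : MvPolynomial (Fin s × Fin (N + 1)) k}
    (hprime : (vanishingIdeal k (power (Fin s) (cone X))).IsPrime)
    (hf : f ∉ vanishingIdeal k (power (Fin s) (cone X)))
    (hf0 : ∀ x ∈ power (Fin s) (cone X), eval x f ≠ 0 → ∀ i, (fun j => x (i, j)) ≠ 0) :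
    {P : Fin s → PP k N | ∀ i, P i ∈ X} ⊆ closure[zariskiPower k N s]
      ({P | ∀ i, P i ∈ X} ∩ {P | scalePoly Prod.fst (fun ij => (P ij.1).rep ij.2) f ≠ 0}) := by
  let := zariskiPower k N s
  intro P hP
  rw [mem_closure_iff]
  intro O hO hPO
  obtain ⟨F, d, hF, hFP, hFO⟩ := exists_multihomogeneous_of_mem_isOpen hO hPO
  have hFf : F * f ∉ vanishingIdeal k (power (Fin s) (cone X)) := by
    intro h
    rcases hprime.mem_or_mem h with h | h
    · exact hFP (mem_vanishingIdeal_iff.1 h _ fun i => rep_mem_cone (hP i))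
    · exact hf h
  obtain ⟨x, hx, hxFf⟩ : ∃ x ∈ power (Fin s) (cone X), eval x (F * f) ≠ 0 := by
    by_contra! h
    exact hFf (mem_vanishingIdeal_iff.2 h)
  rw [map_mul] at hxFf
  have hx0 := hf0 x hx (right_ne_zero_of_mul hxFf)
  choose a ha using fun i => Projectivization.exists_smul_eq_mk_rep k _ (hx0 i)
  have hrep : (fun ij : Fin s × Fin (N + 1) => (Projectivization.mk k _ (hx0 ij.1)).rep ij.2) =
      fun ij => (a ij.1 : k) * x ij := by
    ext ij
    exact (congrFun (ha ij.1) ij.2).symm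
  refine ⟨fun i => Projectivization.mk k _ (hx0 i), hFO _ ?_, fun i => hx i (hx0 i), ?_⟩
  · rw [hrep, eval_scale_of_isMultihomogeneous hF (fun i => (a i : k)) x]
    exact mul_ne_zero (Finset.prod_ne_zero_iff.2 fun i _ => pow_ne_zero _ (a i).ne_zero)
      (left_ne_zero_of_mul hxFf)
  · refine scalePoly_ne_zero_iff_exists_eval.2 ⟨fun i => ((a i)⁻¹ : kˣ), ?_⟩
    change eval (fun ij : Fin s × Fin (N + 1) =>
      (((a ij.1)⁻¹ : kˣ) : k) * (Projectivization.mk k _ (hx0 ij.1)).rep ij.2) f ≠ 0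
    simp only [fun ij => congrFun hrep ij, Units.inv_mul_cancel_left]
    exact right_ne_zero_of_mul hxFf

/-- If the polynomial `f` does not vanish identically on the scalings of a tuple `P`, then a generic
point of the span of `P` has a representative that is the sum of such a scaling at which `f` does
not vanish. The open set is given by the polynomial `q ↦ f ((l q + κ) • P)`, where `l` is a linear
choice of coefficients for vectors in the span and `κ` is a linear relation between
representatives of `P`. -/
theorem holdsGenerically_span_of_scalePoly_ne_zero [Infinite k] {s : ℕ}
    {f : MvPolynomial (Fin s × Fin (N + 1)) k} {P : Fin s → PP k N}
    (hP : scalePoly Prod.fst (fun ij => (P ij.1).rep ij.2) f ≠ 0)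
    (hf : ∀ t : Fin s → k, eval (fun ij => t ij.1 * (P ij.1).rep ij.2) f ≠ 0 →
      ∑ i, t i • (P i).rep ≠ 0) :
    HoldsGenerically (zariski k N)
      (Projectivization.Subspace.span (Set.range P) : Set (PP k N)) fun Q =>
        ∃ (c : k) (t : Fin s → k), eval (fun ij => t ij.1 * (P ij.1).rep ij.2) f ≠ 0 ∧
          c • Q.rep = ∑ i, t i • (P i).rep := by
  let := zariski k N
  obtain ⟨t₀, ht₀⟩ := scalePoly_ne_zero_iff_exists_eval.1 hP
  let B : (Fin s → k) →ₗ[k] (Fin (N + 1) → k) := Fintype.linearCombination k fun i => (P i).rep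
  have hB : ∀ t, B t = ∑ i, t i • (P i).rep := fun t => Fintype.linearCombination_apply k _ t
  obtain ⟨l, hl⟩ := exists_idempotent_section B
  let κ : Fin s → k := t₀ - l (B t₀)
  have hκ : B κ = 0 := by rw [map_sub, hl, sub_self]
  let φ : (Fin (N + 1) → k) →ₗ[k] (Fin s × Fin (N + 1) → k) :=
    LinearMap.pi fun ij => (P ij.1).rep ij.2 • (LinearMap.proj ij.1 ∘ₗ l)
  obtain ⟨g, hg⟩ := exists_polynomial_comp φ (fun ij => κ ij.1 * (P ij.1).rep ij.2) f
  have hg' : ∀ q, eval q g = eval (fun ij => (l q + κ) ij.1 * (P ij.1).rep ij.2) f := by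
    intro q
    rw [hg]
    congr 2
    ext ij
    simp only [φ, LinearMap.pi_apply, Pi.add_apply, LinearMap.smul_apply, LinearMap.comp_apply,
      LinearMap.proj_apply, smul_eq_mul]
    ring
  have hBq : ∀ t, B (l (B t) + κ) = B t := fun t => by rw [map_add, hl, hκ, add_zero]
  have hmem : ∀ Q : PP k N, Q ∈ Projectivization.Subspace.span (Set.range P) ↔
      ∃ t, B t = Q.rep := by
    intro Q
    conv_lhs => rw [← Projectivization.mk_rep Q]
    rw [mk_mem_span_range_iff, Submodule.mem_span_range_iff_exists_fun]
    simp only [hB]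
  refine ⟨{Q | scalePoly (fun _ => ()) Q.rep g ≠ 0}, isOpen_setOf_scalePoly_ne_zero g, ?_, ?_⟩
  · intro Q hQ
    rw [mem_closure_iff]
    intro O hO hQO
    obtain ⟨F, d, hF, hFQ, hFO⟩ := exists_form_of_mem_isOpen hO hQO
    obtain ⟨t₁, ht₁⟩ := (hmem Q).1 hQ
    -- `F` and `g` are both non-zero at some point of the span, since the span is irreducible
    obtain ⟨F', hF'⟩ := exists_polynomial_comp B 0 F
    obtain ⟨g', hg''⟩ := exists_polynomial_comp B 0 g
    simp only [add_zero] at hF' hg''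
    have hne : F' * g' ≠ 0 := by
      refine mul_ne_zero (fun h => hFQ ?_) fun h => ht₀ ?_
      · rw [VanishesAt, ← ht₁, ← hF', h, map_zero]
      · have h0 := hg'' t₀
        rw [h, map_zero, hg', add_sub_cancel] at h0
        exact h0.symm
    obtain ⟨t, ht⟩ : ∃ t, eval t (F' * g') ≠ 0 := by
      by_contra! h
      exact hne (MvPolynomial.funext fun t => by rw [h t, map_zero])
    rw [map_mul, hF', hg''] at ht
    have hgt : eval (B t) g ≠ 0 := right_ne_zero_of_mul ht
    have hne0 : B t ≠ 0 := by
      rw [hg'] at hgt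
      have := hf _ hgt
      rwa [← hB, hBq] at this
    obtain ⟨a, ha⟩ := Projectivization.exists_smul_eq_mk_rep k _ hne0
    refine ⟨Projectivization.mk k _ hne0,
      hFO _ (mt (vanishesAt_mk_iff hF _ hne0).1 (left_ne_zero_of_mul ht)), ?_, ?_⟩
    · refine (hmem _).2 ⟨(a : k) • t, ?_⟩
      rw [map_smul, ← ha]
      rfl
    · refine scalePoly_ne_zero_iff_exists_eval.2 ⟨fun _ => (a⁻¹ : kˣ), ?_⟩
      rw [← ha]
      simpa [Units.smul_def] using hgt
  · rintro Q ⟨hQ, hQg⟩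
    obtain ⟨c, hc⟩ := scalePoly_ne_zero_iff_exists_eval.1 hQg
    obtain ⟨t, ht⟩ := (hmem Q).1 hQ
    have hq : c () • Q.rep = B (c () • t) := by rw [map_smul, ht]
    refine ⟨c (), l (B (c () • t)) + κ, ?_, ?_⟩
    · rw [← hg', ← hq]
      exact hc
    · rw [← hB, hBq, hq]

end Genericity

end Terracini

end

theorem mainTheorem1 {k : Type*} [Field k] [IsAlgClosed k] [CharZero k] (N s : ℕ) (hs : 1 ≤ s)
    (X : Set (Terracini.PP k N)) (hX : Terracini.IsIrreducibleVariety X)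
    (hnd : Terracini.IsNondegenerate X) :
    Terracini.HoldsGenerically (Terracini.zariskiPower k N s)
      {P : Fin s → Terracini.PP k N | ∀ i, P i ∈ X}
      fun P => Terracini.HoldsGenerically (Terracini.zariski k N)
        (Projectivization.Subspace.span (Set.range P) : Set (Terracini.PP k N))
        fun Q => Terracini.tangentSpace (Terracini.secantVariety s X) Q =
          ⨆ i, Terracini.tangentSpace X (P i) := by
  open Terracini MvPolynomial in
  obtain ⟨f, hfJ, hf⟩ := exists_generic_polynomial hX.isIrreducible hs
  have hXne : X.Nonempty := hX.isIrreducible.1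
  refine ⟨{P | scalePoly Prod.fst (fun ij => (P ij.1).rep ij.2) f ≠ 0},
    isOpen_setOf_scalePoly_fst_ne_zero f,
    subset_closure_scalePoly_fst_ne_zero
      (isPrime_vanishingIdeal_power (isPrime_vanishingIdeal_cone hX.isIrreducible)) hfJ
      fun x hx hxf => (hf x hx hxf).1, ?_⟩
  rintro P ⟨hP, hPf⟩
  have hpow : ∀ t : Fin s → k, (fun ij : Fin s × Fin (N + 1) => t ij.1 * (P ij.1).rep ij.2) ∈
      power (Fin s) (cone X) := fun t i => smul_mem_cone (t i) (rep_mem_cone (hP i))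
  have hsum : ∀ t : Fin s → k, ∑ i, t i • (P i).rep = fun j => ∑ i, t i * (P i).rep j := by
    intro t
    ext j
    simp
  obtain ⟨V, hVo, hVd, hV⟩ := holdsGenerically_span_of_scalePoly_ne_zero hPf fun t ht => by
    rw [hsum]
    exact (hf _ (hpow t) ht).2.1
  refine ⟨V, hVo, hVd, fun Q hQ => ?_⟩
  obtain ⟨c, t, htf, hct⟩ := hV Q hQ
  obtain ⟨ht0, hq0, hT⟩ := hf _ (hpow t) htf
  have hσne := secantVariety_nonempty hXne hs
  dsimp only at hq0 hT ht0
  rw [← hsum, ← hct] at hq0 hT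
  have hc : c ≠ 0 := left_ne_zero_of_smul hq0
  have ht : ∀ i, t i ≠ 0 := fun i h => ht0 i (by ext j; simp [h])
  simp only [tangentSpace, affineTangentSpace_eq_coneTangent hσne,
    affineTangentSpace_eq_coneTangent hXne]
  rw [← coneTangent_smul hc (fun c x => smul_mem_cone c), hT, map_iSup]
  refine iSup_congr fun i => ?_
  congr 1
  exact coneTangent_smul (ht i) (fun c x => smul_mem_cone c) (P i).rep
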